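/- Let $\mathbb{N}=\{1,2,3,\dots\}$ and $a\in[0,1)$. Let $J_a$ be the bounded operator on $\ell^2(\mathbb{N})$ (complex sequences) given by $(J_a\psi)_1=a\psi_1+\psi_2$ and $(J_a\psi)_n=\psi_{n-1}+\psi_{n+1}$ for $n\ge 2$, and put $-\Delta_a:=2-J_a$. Let $v=\{v_n\}_{n=1}^\infty$ be an arbitrary complex sequence and $V=\mathrm{diag}(v_1,v_2,\dots)$. For a bounded operator $T$, the continuous spectrum $\sigma_{\mathrm c}(T)$ is the set of $z\in\sigma(T)$ for which $T-z$ is injective and has dense range. Consider the following two conditions. (i) The semi-infinite matrix $$K'_{m,n}=\sqrt{|v_m|}\left[\frac{a}{1-a}+\min(m,n)\right]\sqrt{|v_n|},\qquad m,n\in\mathbb{N},$$ defines a bounded operator $K'$ on $\ell^2(\mathbb{N})$, and $\|K'\|<1$. (ii) There is a real constant $c<1$ such that $|V|\le c(-\Delta_a)$, i.e. $\sum_{n=1}^\infty |v_n||\psi_n|^2\le c\,\langle\psi,(2-J_a)\psi\rangle$ for all $\psi\in\ell^2(\mathbb{N})$ (in particular, the left-hand side is finite). Then (i) and (ii) are equivalent.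 If they hold, then $V$ is a bounded operator on $\ell^2(\mathbb{N})$ and $$\sigma(J_a+V)=\sigma_{\mathrm c}(J_a+V)=\sigma(J_a)=[-2,2].$$ -/

import Mathlib

namespace RobinSpectral

/-- The complex Hilbert space of square-summable sequences indexed by the positive integers. -/
abbrev Ell2 : Type := lp (fun _ : ℕ+ => ℂ) 2

theorem summable_sq (ψ : Ell2) : Summable fun n => ‖ψ n‖ ^ 2 := by
  simpa using (lp.memℓp ψ).summable (by norm_num)

theorem memlp_of_summable_sq {f : ℕ+ → ℂ} (h : Summable fun n => ‖f n‖ ^ 2) :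
    Memℓp f 2 := memℓp_gen (by simpa using h)

theorem norm_sq_eq (ψ : Ell2) : ‖ψ‖ ^ 2 = ∑' n, ‖ψ n‖ ^ 2 := by
  simpa using lp.norm_rpow_eq_tsum (p := 2) (by norm_num) ψ

theorem succ_injective : Function.Injective fun n : ℕ+ => n + 1 :=
  fun _ _ h => add_right_cancel h

theorem succ_ne_one (n : ℕ+) : n + 1 ≠ 1 := by
  intro h
  have := congrArg PNat.val h
  simp at this

/-- The left shift `(ψ₁, ψ₂, …) ↦ (ψ₂, ψ₃, …)`. -/
noncomputable def leftShift : Ell2 →L[ℂ] Ell2 :=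
  LinearMap.mkContinuous
    { toFun := fun ψ => ⟨fun n => ψ (n + 1),
        memlp_of_summable_sq ((summable_sq ψ).comp_injective succ_injective)⟩
      map_add' := fun _ _ => rfl
      map_smul' := fun _ _ => rfl } 1 (fun ψ => by
    rw [one_mul]
    refine le_of_sq_le_sq ?_ (norm_nonneg _)
    rw [norm_sq_eq, norm_sq_eq]
    exact tsum_comp_le_tsum_of_inj (summable_sq ψ) (fun _ => by positivity) succ_injective)

/-- The right shift `(ψ₁, ψ₂, …) ↦ (0, ψ₁, ψ₂, …)`, as the adjoint of the left shift. -/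
noncomputable def rightShift : Ell2 →L[ℂ] Ell2 := ContinuousLinearMap.adjoint leftShift

/-- The orthogonal projection `(ψ₁, ψ₂, …) ↦ (ψ₁, 0, 0, …)` onto the first basis vector. -/
noncomputable def firstProj : Ell2 →L[ℂ] Ell2 :=
  (innerSL ℂ (lp.single 2 (1 : ℕ+) (1 : ℂ) : Ell2)).smulRight (lp.single 2 (1 : ℕ+) (1 : ℂ) : Ell2)

/-- The bounded operator given by the tridiagonal matrix with diagonal `(a, 0, 0, …)` and
with all entries next to the diagonal equal to `1`. -/
noncomputable def robinJacobi (a : ℂ) : Ell2 →L[ℂ] Ell2 :=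
  leftShift + rightShift + a • firstProj

/-- The discrete Robin Laplacian `-Δ_a = 2 - J_a`. -/
noncomputable def negRobinLaplacian (a : ℂ) : Ell2 →L[ℂ] Ell2 :=
  (2 : ℂ) • ContinuousLinearMap.id ℂ Ell2 - robinJacobi a

@[simp] theorem leftShift_apply (ψ : Ell2) (n : ℕ+) : leftShift ψ n = ψ (n + 1) := rfl

theorem coord_eq_inner (ψ : Ell2) (n : ℕ+) :
    ψ n = inner ℂ (lp.single 2 n (1 : ℂ) : Ell2) ψ := by
  simp [lp.inner_single_left]

@[simp] theorem rightShift_apply_one (ψ : Ell2) : rightShift ψ 1 = 0 := by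
  rw [coord_eq_inner, rightShift, ContinuousLinearMap.adjoint_inner_right]
  have : leftShift (lp.single 2 (1 : ℕ+) (1 : ℂ) : Ell2) = 0 := by
    ext n
    simp [lp.single_apply, Pi.single_apply, succ_ne_one]
  simp [this]

@[simp] theorem rightShift_apply_succ (ψ : Ell2) (n : ℕ+) : rightShift ψ (n + 1) = ψ n := by
  rw [coord_eq_inner, rightShift, ContinuousLinearMap.adjoint_inner_right]
  have : leftShift (lp.single 2 (n + 1) (1 : ℂ) : Ell2) = lp.single 2 n (1 : ℂ) := by
    ext m
    simp [lp.single_apply, Pi.single_apply]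
  rw [this, ← coord_eq_inner]

theorem robinJacobi_apply (a : ℂ) (ψ : Ell2) (n : ℕ+) :
    robinJacobi a ψ n =
      leftShift ψ n + rightShift ψ n + a * (ψ 1 * (lp.single 2 (1 : ℕ+) (1 : ℂ) : Ell2) n) := by
  rw [coord_eq_inner ψ 1]
  rfl

theorem robinJacobi_apply_one (a : ℂ) (ψ : Ell2) :
    robinJacobi a ψ 1 = a * ψ 1 + ψ 2 := by
  have h : leftShift ψ 1 = ψ 2 := rfl
  rw [robinJacobi_apply, h, rightShift_apply_one]
  simp [add_comm]

theorem robinJacobi_apply_succ (a : ℂ) (ψ : Ell2) (n : ℕ+) :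
    robinJacobi a ψ (n + 1) = ψ n + ψ (n + 2) := by
  have h : leftShift ψ (n + 1) = ψ (n + 2) := rfl
  rw [robinJacobi_apply, h, rightShift_apply_succ]
  simp [lp.single_apply, Pi.single_apply, succ_ne_one, add_comm]

theorem negRobinLaplacian_apply (a : ℂ) (ψ : Ell2) (n : ℕ+) :
    negRobinLaplacian a ψ n = 2 * ψ n - robinJacobi a ψ n := rfl

/-- `T` is the bounded operator on `ℓ²` whose matrix in the standard basis is `A`. -/
def HasMatrix (T : Ell2 →L[ℂ] Ell2) (A : ℕ+ → ℕ+ → ℂ) : Prop :=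
  ∀ m n : ℕ+, T (lp.single 2 n (1 : ℂ)) m = A m n

/-- `T` is the (everywhere defined, bounded) multiplication operator `diag (v₁, v₂, …)`. -/
def IsDiagonal (T : Ell2 →L[ℂ] Ell2) (v : ℕ+ → ℂ) : Prop :=
  ∀ (ψ : Ell2) (n : ℕ+), T ψ n = v n * ψ n

/-- The matrix `√|v_m| (a / (1 - a) + min (m, n)) √|v_n|`. -/
noncomputable def bsMatrix (a : ℝ) (v : ℕ+ → ℂ) (m n : ℕ+) : ℝ :=
  √‖v m‖ * (a / (1 - a) + ((min m n : ℕ+) : ℝ)) * √‖v n‖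

/-- The matrix `bsMatrix a v` defines a bounded operator on `ℓ²`, of norm less than one. -/
def BSNormLtOne (a : ℝ) (v : ℕ+ → ℂ) : Prop :=
  ∃ K : Ell2 →L[ℂ] Ell2, HasMatrix K (fun m n => (bsMatrix a v m n : ℂ)) ∧ ‖K‖ < 1

/-- The form inequality `⟨ψ, |V| ψ⟩ ≤ c ⟨ψ, -Δ_a ψ⟩` for all `ψ` in `ℓ²`, with `V = diag v`
(the left-hand side being finite). For real `a` the form on the right is real-valued. -/
def FormBound (a : ℝ) (v : ℕ+ → ℂ) (c : ℝ) : Prop :=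
  ∀ ψ : Ell2, (Summable fun n => ‖v n‖ * ‖ψ n‖ ^ 2) ∧
    ∑' n, ‖v n‖ * ‖ψ n‖ ^ 2 ≤ c * (inner ℂ ψ (negRobinLaplacian (a : ℂ) ψ)).re

/-- The continuous spectrum: the spectral points `z` for which `T - z` is injective with dense
range (hence is not surjective). -/
def continuousSpectrum (T : Ell2 →L[ℂ] Ell2) : Set ℂ :=
  {z | z ∈ spectrum ℂ T ∧
    Function.Injective (T - z • ContinuousLinearMap.id ℂ Ell2) ∧
    DenseRange (T - z • ContinuousLinearMap.id ℂ Ell2)}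

end RobinSpectral

namespace RobinSpectral

/-! Write `W` for `|V|^(1/2)`. The Laplacian factors as `-Δ_a = D* D`, with `D` lower bidiagonal,
injective adjoint and dense range. The vectors `stepVec a n` solve `D* g_n = e_n`, so their Gram
matrix `a/(1-a) + min(m,n)` is the kernel of the formal inverse of `-Δ_a`, and `K' = B B*` with `B =
W D⁻¹`. Condition (ii) says `‖W ψ‖² ≤ c ‖D ψ‖²`, that is `‖B‖² ≤ c`, which gives the equivalence
(`formBound_of_hasMatrix`, `bsNormLtOne_of_formBound`).

For the spectrum, put `z = k + k⁻¹` with `0 < |k| ≤ 1`. The Green kernel of `J_a - z` is bounded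
entrywise, uniformly in `z`, by its absolute value at `k = 1`, which is the kernel above. Hence
`(J_a - z) η = V ψ` forces `‖W η‖ ≤ ‖K'‖ ‖W ψ‖` for every complex `z`, even inside `[-2,2]`
(`norm_sqrt_le_of_robinJacobi_sub_eq`). As `‖K'‖ < 1`, no `z` is an eigenvalue; applied to the
adjoint, this gives dense range. Off `[-2,2]` the same estimate bounds `J_a + V - z` below. On
`[-2,2]`, truncated plane waves far from the origin are approximate eigenvectors, because the
diagonal of `K'` forces `|v_n| ≤ 1/n`. -/

/-- The standard basis vector `e_n` of `ℓ²`. -/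
noncomputable abbrev basisVec (n : ℕ+) : Ell2 := lp.single 2 n (1 : ℂ)

/-! ### Adjoints, the bidiagonal factorization of `2 ± J_a`, and its numerical range -/

theorem adjoint_apply_coord (T : Ell2 →L[ℂ] Ell2) (ψ : Ell2) (n : ℕ+) :
    ContinuousLinearMap.adjoint T ψ n = inner ℂ (T (basisVec n)) ψ := by
  rw [coord_eq_inner, ContinuousLinearMap.adjoint_inner_right]

theorem firstProj_apply (ψ : Ell2) : firstProj ψ = ψ 1 • basisVec 1 := by
  rw [coord_eq_inner ψ 1]
  rfl

@[simp] theorem firstProj_apply_one (ψ : Ell2) : firstProj ψ 1 = ψ 1 := by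
  simp [firstProj_apply]

@[simp] theorem firstProj_apply_succ (ψ : Ell2) (n : ℕ+) : firstProj ψ (n + 1) = 0 := by
  simp [firstProj_apply, succ_ne_one]

theorem adjoint_firstProj : ContinuousLinearMap.adjoint firstProj = firstProj := by
  ext ψ n
  rw [adjoint_apply_coord, firstProj_apply, firstProj_apply, inner_smul_left,
    lp.inner_single_left]
  by_cases h : n = 1
  · subst h; simp
  · simp [h, Ne.symm h]

theorem adjoint_rightShift : ContinuousLinearMap.adjoint rightShift = leftShift :=
  ContinuousLinearMap.adjoint_adjoint _

theorem adjoint_robinJacobi (a : ℝ) :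
    ContinuousLinearMap.adjoint (robinJacobi (a : ℂ)) = robinJacobi (a : ℂ) := by
  rw [robinJacobi, map_add, map_add, map_smulₛₗ, adjoint_firstProj, adjoint_rightShift]
  rw [← rightShift, add_comm rightShift]
  simp

theorem ext_coord {x y : Ell2} (h₁ : x 1 = y 1) (h : ∀ n : ℕ+, x (n + 1) = y (n + 1)) :
    x = y := by
  ext n
  induction n using PNat.recOn with
  | one => exact h₁
  | succ n => exact h n

/-- The lower bidiagonal operator with diagonal `(b, 1, 1, …)` and with `s` below the diagonal. -/
noncomputable def bidiagonal (b s : ℝ) : Ell2 →L[ℂ] Ell2 :=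
  ContinuousLinearMap.id ℂ Ell2 + (s : ℂ) • rightShift + ((b - 1 : ℝ) : ℂ) • firstProj

theorem adjoint_bidiagonal (b s : ℝ) : ContinuousLinearMap.adjoint (bidiagonal b s) =
    ContinuousLinearMap.id ℂ Ell2 + (s : ℂ) • leftShift + ((b - 1 : ℝ) : ℂ) • firstProj := by
  have h : ContinuousLinearMap.adjoint (ContinuousLinearMap.id ℂ Ell2) =
      ContinuousLinearMap.id ℂ Ell2 := ContinuousLinearMap.adjoint_id
  rw [bidiagonal, map_add, map_add, map_smulₛₗ, map_smulₛₗ, adjoint_firstProj,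
    adjoint_rightShift, h]
  simp

theorem bidiagonal_apply_one (b s : ℝ) (ψ : Ell2) : bidiagonal b s ψ 1 = b * ψ 1 := by
  have : bidiagonal b s ψ 1 = ψ 1 + s * rightShift ψ 1 + ((b - 1 : ℝ) : ℂ) * firstProj ψ 1 := rfl
  rw [this, rightShift_apply_one, firstProj_apply_one]
  push_cast; ring

theorem bidiagonal_apply_succ (b s : ℝ) (ψ : Ell2) (n : ℕ+) :
    bidiagonal b s ψ (n + 1) = ψ (n + 1) + s * ψ n := by
  have : bidiagonal b s ψ (n + 1) = ψ (n + 1) + s * rightShift ψ (n + 1) +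
    ((b - 1 : ℝ) : ℂ) * firstProj ψ (n + 1) := rfl
  rw [this, rightShift_apply_succ, firstProj_apply_succ]
  ring

theorem adjoint_bidiagonal_apply_one (b s : ℝ) (ψ : Ell2) :
    ContinuousLinearMap.adjoint (bidiagonal b s) ψ 1 = b * ψ 1 + s * ψ 2 := by
  rw [adjoint_bidiagonal]
  change ψ 1 + s * ψ 2 + ((b - 1 : ℝ) : ℂ) * firstProj ψ 1 = _
  rw [firstProj_apply_one]
  push_cast; ring

theorem adjoint_bidiagonal_apply_succ (b s : ℝ) (ψ : Ell2) (n : ℕ+) :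
    ContinuousLinearMap.adjoint (bidiagonal b s) ψ (n + 1) = ψ (n + 1) + s * ψ (n + 2) := by
  rw [adjoint_bidiagonal]
  change ψ (n + 1) + s * ψ (n + 1 + 1) + ((b - 1 : ℝ) : ℂ) * firstProj ψ (n + 1) = _
  rw [firstProj_apply_succ]
  ring_nf
  rfl

/-- The corner entry of the product is `b² + s² = 2 + s a`; the other diagonal entries are `1 + s² =
2`, and the off-diagonal ones are `s`. -/
theorem adjoint_bidiagonal_bidiagonal {a b s : ℝ} (hs : s ^ 2 = 1) (hb : b ^ 2 = 1 + s * a)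
    (ψ : Ell2) : ContinuousLinearMap.adjoint (bidiagonal b s) (bidiagonal b s ψ) =
      (2 : ℂ) • ψ + (s : ℂ) • robinJacobi (a : ℂ) ψ := by
  have hs' : (s : ℂ) ^ 2 = 1 := by exact_mod_cast hs
  have hb' : (b : ℂ) ^ 2 = 1 + s * a := by exact_mod_cast hb
  refine ext_coord ?_ fun n => ?_
  · have h2 : bidiagonal b s ψ 2 = ψ 2 + s * ψ 1 := bidiagonal_apply_succ b s ψ 1
    have h : ((2 : ℂ) • ψ + (s : ℂ) • robinJacobi (a : ℂ) ψ) 1 =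
      2 * ψ 1 + s * robinJacobi (a : ℂ) ψ 1 := rfl
    rw [adjoint_bidiagonal_apply_one, bidiagonal_apply_one, h2, h, robinJacobi_apply_one]
    linear_combination ψ 1 * hs' + ψ 1 * hb'
  · have h2 : bidiagonal b s ψ (n + 2) = ψ (n + 2) + s * ψ (n + 1) :=
      bidiagonal_apply_succ b s ψ (n + 1)
    have h : ((2 : ℂ) • ψ + (s : ℂ) • robinJacobi (a : ℂ) ψ) (n + 1) =
      2 * ψ (n + 1) + s * robinJacobi (a : ℂ) ψ (n + 1) := rfl
    rw [adjoint_bidiagonal_apply_succ, bidiagonal_apply_succ, h2, h, robinJacobi_apply_succ]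
    linear_combination ψ (n + 1) * hs'

theorem inner_self_eq_ofReal (ψ : Ell2) : inner ℂ ψ ψ = ((‖ψ‖ ^ 2 : ℝ) : ℂ) := by
  rw [inner_self_eq_norm_sq_to_K]
  norm_cast

theorem norm_sq_bidiagonal {a b s : ℝ} (hs : s ^ 2 = 1) (hb : b ^ 2 = 1 + s * a) (ψ : Ell2) :
    ‖bidiagonal b s ψ‖ ^ 2 = 2 * ‖ψ‖ ^ 2 + s * (inner ℂ ψ (robinJacobi (a : ℂ) ψ)).re := by
  have h1 := ContinuousLinearMap.adjoint_inner_right (bidiagonal b s) ψ (bidiagonal b s ψ)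
  rw [adjoint_bidiagonal_bidiagonal hs hb, inner_add_right, inner_smul_right, inner_smul_right,
    inner_self_eq_ofReal, inner_self_eq_ofReal] at h1
  have h2 := congrArg Complex.re h1
  rw [Complex.add_re, Complex.re_ofReal_mul, Complex.ofReal_re, ← Complex.ofReal_ofNat,
    ← Complex.ofReal_mul, Complex.ofReal_re] at h2
  exact h2.symm

theorem inner_negRobinLaplacian {a : ℝ} (ha1 : a ≤ 1) (ψ : Ell2) :
    (inner ℂ ψ (negRobinLaplacian (a : ℂ) ψ)).re = ‖bidiagonal √(1 - a) (-1) ψ‖ ^ 2 := by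
  rw [norm_sq_bidiagonal (a := a) (by norm_num)
    (by rw [Real.sq_sqrt (by linarith)]; ring)]
  have : negRobinLaplacian (a : ℂ) ψ = (2 : ℂ) • ψ - robinJacobi (a : ℂ) ψ := rfl
  rw [this, inner_sub_right, inner_smul_right, inner_self_eq_ofReal, Complex.sub_re,
    ← Complex.ofReal_ofNat, ← Complex.ofReal_mul, Complex.ofReal_re]
  ring

/-- Both `2 - J_a` and `2 + J_a` are nonnegative, by the factorization with `s = -1` and `s = 1`. -/
theorem abs_re_inner_robinJacobi_le {a : ℝ} (ha0 : -1 ≤ a) (ha1 : a ≤ 1) (ψ : Ell2) :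
    |(inner ℂ ψ (robinJacobi (a : ℂ) ψ)).re| ≤ 2 * ‖ψ‖ ^ 2 := by
  have h1 := norm_sq_bidiagonal (a := a) (b := √(1 - a)) (s := -1) (by norm_num)
    (by rw [Real.sq_sqrt (by linarith)]; ring) ψ
  have h2 := norm_sq_bidiagonal (a := a) (b := √(1 + a)) (s := 1) (by norm_num)
    (by rw [Real.sq_sqrt (by linarith)]; ring) ψ
  rw [abs_le]
  constructor <;> nlinarith [sq_nonneg ‖bidiagonal √(1 - a) (-1) ψ‖,
    sq_nonneg ‖bidiagonal √(1 + a) 1 ψ‖]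

theorem im_inner_robinJacobi (a : ℝ) (ψ : Ell2) :
    (inner ℂ ψ (robinJacobi (a : ℂ) ψ)).im = 0 := by
  have h := ContinuousLinearMap.adjoint_inner_left (robinJacobi (a : ℂ)) ψ ψ
  rw [adjoint_robinJacobi, ← inner_conj_symm] at h
  exact Complex.conj_eq_iff_im.mp h

/-- Outside the numerical range `[-2, 2]`, the operator `J_a - z` is invertible. -/
theorem isUnit_robinJacobi_sub {a : ℝ} (ha0 : -1 ≤ a) (ha1 : a ≤ 1) {z : ℂ}
    (hz : z ∉ Complex.ofReal '' Set.Icc (-2 : ℝ) 2) :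
    IsUnit (robinJacobi (a : ℂ) - z • ContinuousLinearMap.id ℂ Ell2) := by
  have hclosed : IsClosed (Complex.ofReal '' Set.Icc (-2 : ℝ) 2) :=
    (isCompact_Icc.image Complex.continuous_ofReal).isClosed
  obtain ⟨c, hc, hball⟩ := Metric.isOpen_iff.mp hclosed.isOpen_compl z hz
  refine ContinuousLinearMap.isUnit_of_forall_le_norm_inner_map _ (c := ⟨c, hc.le⟩) hc fun x => ?_
  rcases eq_or_ne x 0 with rfl | hx
  · simp
  have hx2 : 0 < ‖x‖ ^ 2 := by positivity
  set r : ℝ := (inner ℂ x (robinJacobi (a : ℂ) x)).re / ‖x‖ ^ 2 with hr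
  have hrmem : r ∈ Set.Icc (-2 : ℝ) 2 := by
    have := abs_le.mp (abs_re_inner_robinJacobi_le ha0 ha1 x)
    rw [hr, Set.mem_Icc, le_div_iff₀ hx2, div_le_iff₀ hx2]
    constructor <;> linarith [this.1, this.2]
  have hJ : inner ℂ x (robinJacobi (a : ℂ) x) = ((r * ‖x‖ ^ 2 : ℝ) : ℂ) := by
    apply Complex.ext
    · rw [Complex.ofReal_re, hr]; field_simp
    · rw [im_inner_robinJacobi, Complex.ofReal_im]
  have hin : inner ℂ x ((robinJacobi (a : ℂ) - z • ContinuousLinearMap.id ℂ Ell2) x) =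
      ((r : ℂ) - z) * (‖x‖ ^ 2 : ℝ) := by
    have : (robinJacobi (a : ℂ) - z • ContinuousLinearMap.id ℂ Ell2) x =
      robinJacobi (a : ℂ) x - z • x := rfl
    rw [this, inner_sub_right, inner_smul_right, hJ, inner_self_eq_ofReal]
    push_cast
    ring
  have hdist : c ≤ ‖(r : ℂ) - z‖ := by
    by_contra! hlt
    exact hball (by rwa [Metric.mem_ball, dist_eq_norm]) (Set.mem_image_of_mem _ hrmem)
  rw [← norm_inner_symm, hin, norm_mul, Complex.norm_real, Real.norm_of_nonneg hx2.le, mul_comm]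
  exact mul_le_mul_of_nonneg_right hdist hx2.le

/-! ### Density of the range of `D`, and the preimages of basis vectors under `D*` -/

theorem denseRange_of_adjoint_injective {T : Ell2 →L[ℂ] Ell2}
    (h : Function.Injective (ContinuousLinearMap.adjoint T)) : DenseRange T := by
  have h1 : T.rangeᗮ = ⊥ := by
    rw [ContinuousLinearMap.orthogonal_range]
    exact LinearMap.ker_eq_bot.mpr h
  have h2 := (Submodule.topologicalClosure_eq_top_iff (K := T.range)).mpr h1
  exact Submodule.dense_iff_topologicalClosure_eq_top.mpr h2

theorem tendsto_coord (ψ : Ell2) : Filter.Tendsto ψ Filter.cofinite (nhds 0) := by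
  have h := (summable_sq ψ).tendsto_cofinite_zero
  rw [tendsto_zero_iff_norm_tendsto_zero]
  simpa using h.sqrt

theorem tendsto_coord_succPNat (ψ : Ell2) :
    Filter.Tendsto (fun n : ℕ => ψ n.succPNat) Filter.atTop (nhds 0) := by
  rw [← Nat.cofinite_eq_atTop]
  exact (tendsto_coord ψ).comp Nat.succPNat_injective.tendsto_cofinite

/-- A kernel vector is constant from the second entry on, hence zero there by square-summability; `b
≠ 0` then kills the first entry. -/
theorem adjoint_bidiagonal_injective {b : ℝ} (hb : b ≠ 0) :
    Function.Injective (ContinuousLinearMap.adjoint (bidiagonal b (-1))) := by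
  refine (injective_iff_map_eq_zero _).mpr fun ψ hψ => ?_
  have h1 : (b : ℂ) * ψ 1 - ψ 2 = 0 := by
    have := adjoint_bidiagonal_apply_one b (-1) ψ
    rw [hψ] at this
    simpa [sub_eq_add_neg] using this.symm
  have h2 (n : ℕ+) : ψ (n + 1) = ψ (n + 2) := by
    have := adjoint_bidiagonal_apply_succ b (-1) ψ n
    rw [hψ] at this
    simpa [← sub_eq_add_neg, sub_eq_zero] using this.symm
  have h3 (n : ℕ) : ψ (n + 1).succPNat = ψ 2 := by
    induction n with
    | zero => rfl
    | succ n ih => rw [← ih]; exact (h2 n.succPNat).symm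
  have h4 : ψ 2 = 0 := by
    have h := (tendsto_coord_succPNat ψ).comp (Filter.tendsto_add_atTop_nat 1)
    exact tendsto_nhds_unique tendsto_const_nhds (h.congr h3)
  have h5 : ψ 1 = 0 := by simpa [h4, hb] using h1
  refine ext_coord h5 fun n => ?_
  obtain ⟨k, rfl⟩ : ∃ k : ℕ, k.succPNat = n := ⟨n.natPred, n.succPNat_natPred⟩
  exact (h3 k).trans h4

/-- The vector `(1 / √(1 - a), 1, …, 1, 0, …)` with `n` nonzero entries. -/
noncomputable def stepVec (a : ℝ) (n : ℕ+) : Ell2 :=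
  ∑ j ∈ Finset.Icc 1 n, lp.single 2 j (if j = 1 then ((√(1 - a))⁻¹ : ℂ) else 1)

theorem stepVec_apply (a : ℝ) (n m : ℕ+) :
    stepVec a n m = if m ≤ n then (if m = 1 then ((√(1 - a))⁻¹ : ℂ) else 1) else 0 := by
  rw [stepVec, lp.coeFn_sum, Finset.sum_apply]
  simp [Pi.single_apply]

theorem stepVec_one (a : ℝ) : stepVec a 1 = ((√(1 - a))⁻¹ : ℂ) • basisVec 1 := by
  simp [stepVec, ← lp.single_smul]

theorem stepVec_succ (a : ℝ) (n : ℕ+) : stepVec a (n + 1) = stepVec a n + basisVec (n + 1) := by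
  refine ext_coord ?_ fun m => ?_
  · have h : (stepVec a n + basisVec (n + 1)) 1 = stepVec a n 1 + basisVec (n + 1) 1 := rfl
    rw [h, stepVec_apply, stepVec_apply]
    simp [succ_ne_one]
  · have h : (stepVec a n + basisVec (n + 1)) (m + 1) =
      stepVec a n (m + 1) + basisVec (n + 1) (m + 1) := rfl
    rw [h, stepVec_apply, stepVec_apply]
    simp only [succ_ne_one, if_false, lp.single_apply, Pi.single_apply, add_left_inj,
      add_le_add_iff_right, PNat.add_one_le_iff]
    rcases lt_trichotomy m n with h | h | h
    · simp [h, h.le, h.ne]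
    · simp [h]
    · simp [h.not_ge, h.not_gt, h.ne']

/-- The shared corner contributes `1/(1-a) = a/(1-a) + 1`, and each further common entry contributes
1. -/
theorem inner_stepVec {a : ℝ} (ha1 : a < 1) (m n : ℕ+) : inner ℂ (stepVec a m) (stepVec a n) =
    ((a / (1 - a) + ((min m n : ℕ+) : ℝ) : ℝ) : ℂ) := by
  induction m using PNat.recOn with
  | one =>
    have h0 : 0 < 1 - a := by linarith
    have hs : √(1 - a) * √(1 - a) = 1 - a := Real.mul_self_sqrt h0.le
    rw [stepVec_one, inner_smul_left, lp.inner_single_left, stepVec_apply]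
    have : (√(1 - a))⁻¹ * (√(1 - a))⁻¹ = a / (1 - a) + 1 := by
      rw [← mul_inv, hs]
      field_simp
      ring
    have h1 : min 1 n = 1 := min_eq_left one_le
    rw [h1]
    simp only [one_le, if_true]
    simp only [map_inv₀, Complex.conj_ofReal, RCLike.inner_apply, map_one, mul_one, PNat.one_coe,
      Nat.cast_one]
    rw [← this]
    push_cast
    ring
  | succ m ih =>
    rw [stepVec_succ, inner_add_left, ih, lp.inner_single_left, stepVec_apply]
    simp only [succ_ne_one, if_false]
    by_cases h : m + 1 ≤ n
    · rw [if_pos h, min_eq_left h, min_eq_left (le_trans (PNat.lt_add_right m 1).le h)]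
      simp
      ring
    · have h' : n ≤ m := PNat.lt_add_one_iff.mp (not_le.mp h)
      rw [if_neg h, min_eq_right h', min_eq_right (not_le.mp h).le]
      simp

/-- `D*` takes differences, so only the jump after position `n` survives; the corner weight
`1/√(1-a)` makes the first difference cancel when `n > 1`. -/
theorem adjoint_bidiagonal_stepVec {a : ℝ} (ha1 : a < 1) (n : ℕ+) :
    ContinuousLinearMap.adjoint (bidiagonal √(1 - a) (-1)) (stepVec a n) = basisVec n := by
  have hs : (√(1 - a) : ℂ) ≠ 0 := by
    exact_mod_cast (Real.sqrt_pos.mpr (by linarith)).ne'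
  refine ext_coord ?_ fun m => ?_
  · rw [adjoint_bidiagonal_apply_one, stepVec_apply, stepVec_apply, if_pos one_le]
    have h2 : (2 : ℕ+) ≠ 1 := by decide
    by_cases h : n = 1
    · subst h
      have : ¬ (2 : ℕ+) ≤ 1 := by decide
      simp [hs, this]
    · have h3 : (2 : ℕ+) ≤ n := PNat.add_one_le_iff.mpr (lt_of_le_of_ne one_le (Ne.symm h))
      simp [hs, h3, h2, h]
  · have h2 : m + 2 ≠ 1 := succ_ne_one (m + 1)
    have h3 : m + 2 = (m + 1) + 1 := rfl
    rw [adjoint_bidiagonal_apply_succ, stepVec_apply, stepVec_apply]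
    simp only [succ_ne_one, h2, if_false, lp.single_apply, Pi.single_apply]
    simp only [h3, PNat.add_one_le_iff (a := m + 1)]
    rcases lt_trichotomy (m + 1) n with h | h | h
    · simp [h, h.le, h.ne]
    · simp [h]
    · simp [h.not_ge, h.not_gt, h.ne']

/-! ### Equivalence of the norm bound and the form bound -/

/-- The diagonal operator with bounded diagonal `w`. -/
noncomputable def diagonal (w : ℕ+ → ℂ) (C : ℝ) (hw : ∀ n, ‖w n‖ ≤ C) : Ell2 →L[ℂ] Ell2 :=
  have key (ψ : Ell2) (n : ℕ+) : ‖w n * ψ n‖ ^ 2 ≤ C ^ 2 * ‖ψ n‖ ^ 2 := by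
    rw [norm_mul, mul_pow]
    gcongr
    exact hw n
  LinearMap.mkContinuous
    { toFun := fun ψ => ⟨fun n => w n * ψ n, memlp_of_summable_sq
        (.of_nonneg_of_le (fun _ => by positivity) (key ψ) ((summable_sq ψ).mul_left _))⟩
      map_add' := fun x y => by ext n; exact mul_add _ _ _
      map_smul' := fun c x => by ext n; exact mul_left_comm _ _ _ } C (fun ψ => by
    have hC : 0 ≤ C := (norm_nonneg _).trans (hw 1)
    refine le_of_sq_le_sq ?_ (by positivity)
    rw [mul_pow, norm_sq_eq, norm_sq_eq, ← tsum_mul_left]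
    exact Summable.tsum_le_tsum (key ψ) (.of_nonneg_of_le (fun _ => by positivity) (key ψ)
      ((summable_sq ψ).mul_left _)) ((summable_sq ψ).mul_left _))

theorem isDiagonal_diagonal (w : ℕ+ → ℂ) (C : ℝ) (hw : ∀ n, ‖w n‖ ≤ C) :
    IsDiagonal (diagonal w C hw) w := fun _ _ => rfl

/-- A Bessel inequality for a family whose Gram matrix is bounded. -/
theorem sum_norm_sq_inner_le {b : ℕ+ → Ell2} {K : Ell2 →L[ℂ] Ell2}
    (hK : HasMatrix K fun m n => inner ℂ (b m) (b n)) (x : Ell2) (s : Finset ℕ+) :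
    ∑ n ∈ s, ‖inner ℂ (b n) x‖ ^ 2 ≤ ‖K‖ * ‖x‖ ^ 2 := by
  set f : ℕ+ → ℂ := fun n => inner ℂ (b n) x with hf
  set S : ℝ := ∑ n ∈ s, ‖f n‖ ^ 2 with hS
  set F : Ell2 := ∑ n ∈ s, f n • basisVec n with hF
  -- Duality: `S = ⟨y, x⟩` while `‖y‖² = ⟨F, K F⟩ ≤ ‖K‖ S`; Cauchy–Schwarz then gives `S² ≤ ‖K‖ S
  -- ‖x‖²`, and one factor `S` cancels.
  set y : Ell2 := ∑ n ∈ s, f n • b n with hy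
  have hS0 : 0 ≤ S := Finset.sum_nonneg fun _ _ => by positivity
  have hFn : ‖F‖ ^ 2 = S := by
    have := lp.norm_sum_single (E := fun _ : ℕ+ => ℂ) (p := 2) (by norm_num) f s
    simp only [ENNReal.toReal_ofNat, Real.rpow_ofNat] at this
    rw [hS, ← this, hF]
    simp [← lp.single_smul]
  have hyx : inner ℂ y x = (S : ℂ) := by
    rw [hy, sum_inner, hS]
    push_cast
    refine Finset.sum_congr rfl fun n _ => ?_
    rw [inner_smul_left, Complex.conj_mul']
  have hyy : inner ℂ y y = inner ℂ F (K F) := by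
    rw [hy, hF, map_sum, sum_inner, sum_inner]
    refine Finset.sum_congr rfl fun m _ => ?_
    rw [inner_sum, inner_sum]
    refine Finset.sum_congr rfl fun n _ => ?_
    rw [map_smul, inner_smul_left, inner_smul_left, inner_smul_right, inner_smul_right,
      ← coord_eq_inner, hK m n]
  have hy2 : ‖y‖ ^ 2 ≤ ‖K‖ * S := by
    have h1 : ‖(inner ℂ y y : ℂ)‖ = ‖y‖ ^ 2 := by
      rw [inner_self_eq_ofReal, Complex.norm_real, Real.norm_of_nonneg (by positivity)]
    calc ‖y‖ ^ 2 = ‖(inner ℂ F (K F) : ℂ)‖ := by rw [← h1, hyy]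
      _ ≤ ‖F‖ * ‖K F‖ := norm_inner_le_norm _ _
      _ ≤ ‖F‖ * (‖K‖ * ‖F‖) := by gcongr; exact K.le_opNorm F
      _ = ‖K‖ * S := by rw [← hFn]; ring
  have hSle : S ≤ ‖y‖ * ‖x‖ := by
    have h1 := norm_inner_le_norm (𝕜 := ℂ) y x
    rwa [hyx, Complex.norm_real, Real.norm_of_nonneg hS0] at h1
  rcases hS0.eq_or_lt with h0 | h0
  · rw [← h0]; positivity
  · have : S * S ≤ S * (‖K‖ * ‖x‖ ^ 2) := by
      calc S * S ≤ (‖y‖ * ‖x‖) * (‖y‖ * ‖x‖) := by gcongr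
        _ = ‖y‖ ^ 2 * ‖x‖ ^ 2 := by ring
        _ ≤ (‖K‖ * S) * ‖x‖ ^ 2 := by gcongr
        _ = _ := by ring
    exact le_of_mul_le_mul_left this h0

/-- The vectors `√|v_n| • stepVec a n`, whose Gram matrix is `bsMatrix a v`. -/
noncomputable def gramVec (a : ℝ) (v : ℕ+ → ℂ) (n : ℕ+) : Ell2 := (√‖v n‖ : ℂ) • stepVec a n

theorem inner_gramVec {a : ℝ} (ha1 : a < 1) (v : ℕ+ → ℂ) (m n : ℕ+) :
    inner ℂ (gramVec a v m) (gramVec a v n) = (bsMatrix a v m n : ℂ) := by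
  rw [gramVec, gramVec, inner_smul_left, inner_smul_right, inner_stepVec ha1, bsMatrix,
    Complex.conj_ofReal]
  push_cast
  ring

theorem inner_gramVec_bidiagonal {a : ℝ} (ha1 : a < 1) (v : ℕ+ → ℂ) (n : ℕ+) (ψ : Ell2) :
    inner ℂ (gramVec a v n) (bidiagonal √(1 - a) (-1) ψ) = √‖v n‖ * ψ n := by
  rw [gramVec, inner_smul_left, ← ContinuousLinearMap.adjoint_inner_left,
    adjoint_bidiagonal_stepVec ha1, ← coord_eq_inner, Complex.conj_ofReal]

theorem norm_sq_sqrt_mul (x : ℂ) (y : ℂ) : ‖(√‖x‖ : ℂ) * y‖ ^ 2 = ‖x‖ * ‖y‖ ^ 2 := by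
  rw [norm_mul, mul_pow, Complex.norm_real, Real.norm_of_nonneg (Real.sqrt_nonneg _),
    Real.sq_sqrt (norm_nonneg _)]

/-- The Bessel inequality for `gramVec a v` at the vector `D ψ`, whose coefficients are `√|v_n|
ψ_n`. -/
theorem formBound_of_hasMatrix {a : ℝ} (ha1 : a < 1) {v : ℕ+ → ℂ} {K : Ell2 →L[ℂ] Ell2}
    (hK : HasMatrix K fun m n => (bsMatrix a v m n : ℂ)) : FormBound a v ‖K‖ := by
  intro ψ
  have hK' : HasMatrix K fun m n => inner ℂ (gramVec a v m) (gramVec a v n) := by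
    simpa only [inner_gramVec ha1] using hK
  have key := sum_norm_sq_inner_le hK' (bidiagonal √(1 - a) (-1) ψ)
  simp only [inner_gramVec_bidiagonal ha1, norm_sq_sqrt_mul] at key
  rw [inner_negRobinLaplacian ha1.le]
  have hsum := summable_of_sum_le (fun n => by positivity) key
  exact ⟨hsum, hsum.tsum_le_of_sum_le key⟩

theorem bsNormLtOne_of_formBound {a : ℝ} (ha1 : a < 1) {v : ℕ+ → ℂ} {c : ℝ} (hc : c < 1)
    (h : FormBound a v c) : BSNormLtOne a v := by
  set D := bidiagonal √(1 - a) (-1) with hD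
  -- `c` may be negative, and the square root of the constant is needed.
  set q := max c 0 with hq
  have hq0 : 0 ≤ q := le_max_right _ _
  have hbound (ψ : Ell2) : ∑' n, ‖v n‖ * ‖ψ n‖ ^ 2 ≤ q * ‖D ψ‖ ^ 2 := by
    refine (h ψ).2.trans ?_
    rw [inner_negRobinLaplacian ha1.le]
    gcongr
    exact le_max_left _ _
  -- Testing the form bound on basis vectors shows that `v` is bounded, so `W` is an everywhere
  -- defined bounded operator.
  have hv (n : ℕ+) : ‖((√‖v n‖ : ℝ) : ℂ)‖ ≤ √(q * ‖D‖ ^ 2) := by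
    rw [Complex.norm_real, Real.norm_of_nonneg (Real.sqrt_nonneg _)]
    refine Real.sqrt_le_sqrt ?_
    have hn : ‖basisVec n‖ = 1 := by
      rw [basisVec, lp.norm_single (by norm_num), norm_one]
    calc ‖v n‖ = ‖v n‖ * ‖basisVec n n‖ ^ 2 := by simp
      _ ≤ ∑' k, ‖v k‖ * ‖basisVec n k‖ ^ 2 :=
        (h (basisVec n)).1.le_tsum n fun _ _ => by positivity
      _ ≤ q * ‖D (basisVec n)‖ ^ 2 := hbound _
      _ ≤ q * ‖D‖ ^ 2 := by
        gcongr
        simpa [hn] using D.le_opNorm (basisVec n)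
  set W := diagonal (fun n => (√‖v n‖ : ℂ)) _ hv with hWdef
  have hW (ψ : Ell2) (n : ℕ+) : W ψ n = √‖v n‖ * ψ n := rfl
  have hWD (ψ : Ell2) : ‖W ψ‖ ≤ √q * ‖D ψ‖ := by
    refine le_of_sq_le_sq ?_ (by positivity)
    rw [mul_pow, Real.sq_sqrt hq0, norm_sq_eq]
    simp_rw [hW, norm_sq_sqrt_mul]
    exact hbound ψ
  have hs : √(1 - a) ≠ 0 := (Real.sqrt_pos.mpr (by linarith)).ne'
  have hinj := adjoint_bidiagonal_injective hs
  have hdense : DenseRange (D : Ell2 →ₗ[ℂ] Ell2) := denseRange_of_adjoint_injective hinj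
  -- `B` is the continuous extension of `W D⁻¹` from the dense range of `D`.
  set B : Ell2 →L[ℂ] Ell2 := (W : Ell2 →ₗ[ℂ] Ell2).extendOfNorm (D : Ell2 →ₗ[ℂ] Ell2) with hBdef
  have hB (ψ : Ell2) : B (D ψ) = W ψ := LinearMap.extendOfNorm_eq hdense ⟨_, hWD⟩ ψ
  have hBn : ‖B‖ ≤ √q := LinearMap.opNorm_extendOfNorm_le hdense (Real.sqrt_nonneg _) hWD
  have hBadj (n : ℕ+) : ContinuousLinearMap.adjoint B (basisVec n) = gramVec a v n := by
    refine hinj (ext_inner_right ℂ fun ψ => ?_)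
    rw [ContinuousLinearMap.adjoint_inner_left, ContinuousLinearMap.adjoint_inner_left,
      ContinuousLinearMap.adjoint_inner_left, inner_gramVec_bidiagonal ha1, ← hD, hB,
      ← coord_eq_inner, hW]
  refine ⟨B ∘L ContinuousLinearMap.adjoint B, fun m n => ?_, ?_⟩
  · change B (ContinuousLinearMap.adjoint B (basisVec n)) m = (bsMatrix a v m n : ℂ)
    rw [← inner_gramVec ha1, ← hBadj m, ContinuousLinearMap.adjoint_inner_left,
      ← coord_eq_inner, hBadj]
  · calc ‖B ∘L ContinuousLinearMap.adjoint B‖ ≤ ‖B‖ * ‖ContinuousLinearMap.adjoint B‖ :=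
        ContinuousLinearMap.opNorm_comp_le _ _
      _ = ‖B‖ * ‖B‖ := by rw [LinearIsometryEquiv.norm_map]
      _ ≤ √q * √q := by gcongr
      _ = q := Real.mul_self_sqrt hq0
      _ < 1 := max_lt hc one_pos

theorem bsNormLtOne_iff_formBound {a : ℝ} (ha1 : a < 1) (v : ℕ+ → ℂ) :
    BSNormLtOne a v ↔ ∃ c : ℝ, c < 1 ∧ FormBound a v c :=
  ⟨fun ⟨_, hK, hn⟩ => ⟨_, hn, formBound_of_hasMatrix ha1 hK⟩,
    fun ⟨_, hc, h⟩ => bsNormLtOne_of_formBound ha1 hc h⟩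

/-! ### The Green kernel of `J_a - z` and its bound uniform in `z` -/

/-- The tridiagonal difference expression of `J_a - z`, on sequences indexed from zero. -/
def jacobiSeq (a z : ℂ) (x : ℕ → ℂ) : ℕ → ℂ
  | 0 => (a - z) * x 0 + x 1
  | j + 1 => x j + x (j + 2) - z * x (j + 1)

/-- Discrete Green identity. The boundary condition at 0 is built into `jacobiSeq`, so only the
Wronskian at the upper end remains. -/
theorem sum_jacobiSeq (a z : ℂ) (u x : ℕ → ℂ) (M : ℕ) :
    ∑ j ∈ Finset.range (M + 1), (u j * jacobiSeq a z x j - jacobiSeq a z u j * x j) =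
      u M * x (M + 1) - u (M + 1) * x M := by
  induction M with
  | zero => simp [jacobiSeq]; ring
  | succ M ih => rw [Finset.sum_range_succ, ih]; simp only [jacobiSeq]; ring

/-- The diagonal of the Green kernel, up to the factor `-k`. -/
noncomputable def greenDiag (a k : ℂ) : ℕ → ℂ
  | 0 => (1 - a * k)⁻¹
  | m + 1 => 1 + k ^ 2 * greenDiag a k m

/-- The Green kernel of `J_a - (k + k⁻¹)`, indexed from zero. -/
noncomputable def greenKernel (a k : ℂ) (n j : ℕ) : ℂ :=
  if j ≤ n then -(k ^ (n - j + 1) * greenDiag a k j) else -(k ^ (j - n + 1) * greenDiag a k n)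

theorem greenKernel_left (a k : ℂ) (j d : ℕ) :
    greenKernel a k (j + d) j = -(k ^ (d + 1) * greenDiag a k j) := by
  simp [greenKernel]

theorem greenKernel_right (a k : ℂ) (n d : ℕ) :
    greenKernel a k n (n + d) = -(k ^ (d + 1) * greenDiag a k n) := by
  rcases d with _ | d
  · simp [greenKernel]
  · simp [greenKernel]

/-- As a function of `j`, the kernel is a multiple of `k^j` to the right of `n`, and of `k^(-j) *
greenDiag a k j`, the solution obeying the boundary condition, to the left. -/
theorem jacobiSeq_greenKernel {a k : ℂ} (hk : k ≠ 0) (hak : 1 - a * k ≠ 0) (n j : ℕ) :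
    jacobiSeq a (k + k⁻¹) (greenKernel a k n) j = if j = n then 1 else 0 := by
  have h0 : (1 - a * k) * greenDiag a k 0 = 1 := mul_inv_cancel₀ hak
  have hs (m : ℕ) : greenDiag a k (m + 1) = 1 + k ^ 2 * greenDiag a k m := rfl
  have hkk : k * k⁻¹ = 1 := mul_inv_cancel₀ hk
  rcases j with _ | j
  · rcases n with _ | n
    · have e0 := greenKernel_right a k 0 0
      have e1 := greenKernel_right a k 0 1
      simp only [zero_add, add_zero] at e0 e1
      simp only [jacobiSeq, e0, e1, if_true]
      linear_combination h0 + greenDiag a k 0 * hkk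
    · have e0 := greenKernel_left a k 0 (n + 1)
      have e1 := greenKernel_left a k 1 n
      rw [zero_add] at e0
      rw [add_comm 1 n] at e1
      simp only [jacobiSeq, e0, e1, hs 0]
      rw [if_neg (by omega)]
      linear_combination k ^ (n + 1) * h0 + k ^ (n + 1) * greenDiag a k 0 * hkk
  · rcases lt_trichotomy (j + 1) n with h | h | h
    · obtain ⟨d, rfl⟩ : ∃ d, n = j + 2 + d := ⟨n - (j + 2), by omega⟩
      have e0 := greenKernel_left a k j (d + 2)
      have e1 := greenKernel_left a k (j + 1) (d + 1)
      have e2 := greenKernel_left a k (j + 2) d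
      rw [show j + (d + 2) = j + 2 + d by ring] at e0
      rw [show j + 1 + (d + 1) = j + 2 + d by ring] at e1
      simp only [jacobiSeq, e0, e1, e2]
      rw [if_neg h.ne, hs (j + 1), hs j]
      linear_combination k ^ (d + 1) * (1 + k ^ 2 * greenDiag a k j) * hkk
    · subst h
      have e0 := greenKernel_left a k j 1
      have e1 := greenKernel_left a k (j + 1) 0
      have e2 := greenKernel_right a k (j + 1) 1
      simp only [jacobiSeq, e0, e1, e2, if_true]
      rw [hs j]
      linear_combination (1 + k ^ 2 * greenDiag a k j) * hkk
    · obtain ⟨d, rfl⟩ : ∃ d, j = n + d := ⟨j - n, by omega⟩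
      have e0 := greenKernel_right a k n d
      have e1 := greenKernel_right a k n (d + 1)
      have e2 := greenKernel_right a k n (d + 2)
      simp only [← add_assoc] at e1 e2
      simp only [jacobiSeq, e0, e1, e2]
      rw [if_neg h.ne']
      linear_combination k ^ (d + 1) * greenDiag a k n * hkk

theorem le_norm_one_sub_mul {a : ℝ} (ha0 : 0 ≤ a) {k : ℂ} (hk1 : ‖k‖ ≤ 1) :
    1 - a ≤ ‖1 - (a : ℂ) * k‖ := by
  have h1 : ‖(a : ℂ) * k‖ ≤ a := by
    rw [norm_mul, Complex.norm_real, Real.norm_of_nonneg ha0]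
    exact mul_le_of_le_one_right ha0 hk1
  have h2 := norm_sub_norm_le (1 : ℂ) ((a : ℂ) * k)
  rw [norm_one] at h2
  linarith

/-- The recursion never divides by `1 - k²`, so the bound includes `k = ±1`; at `k = 1` it is an
equality. -/
theorem norm_greenDiag_le {a : ℝ} (ha0 : 0 ≤ a) (ha1 : a < 1) {k : ℂ} (hk1 : ‖k‖ ≤ 1) (m : ℕ) :
    ‖greenDiag a k m‖ ≤ a / (1 - a) + (m + 1) := by
  induction m with
  | zero =>
    have h0 : 0 < 1 - a := by linarith
    rw [greenDiag, norm_inv]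
    calc ‖1 - (a : ℂ) * k‖⁻¹ ≤ (1 - a)⁻¹ := inv_anti₀ h0 (le_norm_one_sub_mul ha0 hk1)
      _ = a / (1 - a) + ((0 : ℕ) + 1) := by push_cast; field_simp; ring
  | succ m ih =>
    rw [greenDiag]
    have h1 : ‖k ^ 2 * greenDiag a k m‖ ≤ ‖greenDiag a k m‖ := by
      rw [norm_mul, norm_pow]
      exact mul_le_of_le_one_left (norm_nonneg _) (pow_le_one₀ (norm_nonneg _) hk1)
    have h2 := norm_add_le (1 : ℂ) (k ^ 2 * greenDiag a k m)
    rw [norm_one] at h2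
    push_cast
    linarith

theorem norm_greenKernel_le {a : ℝ} (ha0 : 0 ≤ a) (ha1 : a < 1) {k : ℂ} (hk1 : ‖k‖ ≤ 1)
    (n j : ℕ) : ‖greenKernel a k n j‖ ≤ a / (1 - a) + ((min n j : ℕ) + 1) := by
  have key (d m : ℕ) : ‖-(k ^ d * greenDiag a k m)‖ ≤ a / (1 - a) + (m + 1) := by
    rw [norm_neg, norm_mul, norm_pow]
    exact (mul_le_of_le_one_left (norm_nonneg _) (pow_le_one₀ (norm_nonneg _) hk1)).trans
      (norm_greenDiag_le ha0 ha1 hk1 m)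
  rw [greenKernel]
  split_ifs with h
  · rw [min_eq_right h]; exact key _ _
  · rw [min_eq_left (not_le.mp h).le]; exact key _ _

/-- The roots of `k² - z k + 1` have product 1, so one of them lies in the closed unit disc. -/
theorem exists_eq_add_inv (z : ℂ) : ∃ k : ℂ, k ≠ 0 ∧ ‖k‖ ≤ 1 ∧ z = k + k⁻¹ := by
  obtain ⟨s, hs⟩ := IsAlgClosed.exists_pow_nat_eq (z ^ 2 - 4) (n := 2) (by norm_num)
  have hp : ((z + s) / 2) * ((z - s) / 2) = 1 := by linear_combination -hs / 4
  have h1 : (z + s) / 2 ≠ 0 := left_ne_zero_of_mul_eq_one hp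
  have h2 : (z - s) / 2 ≠ 0 := right_ne_zero_of_mul_eq_one hp
  rcases le_total ‖(z + s) / 2‖ 1 with h | h
  · refine ⟨_, h1, h, ?_⟩
    rw [← eq_inv_of_mul_eq_one_right hp]
    ring
  · refine ⟨_, h2, ?_, ?_⟩
    · rw [eq_inv_of_mul_eq_one_right hp, norm_inv]
      exact inv_le_one_of_one_le₀ h
    · rw [← eq_inv_of_mul_eq_one_left hp]
      ring

theorem robinJacobi_sub_succPNat (a z : ℂ) (η : Ell2) (j : ℕ) :
    robinJacobi a η j.succPNat - z * η j.succPNat =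
      jacobiSeq a z (fun i => η i.succPNat) j := by
  rcases j with _ | j
  · have h := robinJacobi_apply_one a η
    change robinJacobi a η 1 - z * η 1 = (a - z) * η 1 + η 2
    rw [h]; ring
  · have h := robinJacobi_apply_succ a η j.succPNat
    change robinJacobi a η (j.succPNat + 1) - z * η (j.succPNat + 1) =
      η j.succPNat + η (j.succPNat + 2) - z * η (j.succPNat + 1)
    rw [h]

/-- The Green representation of `η` through `(J_a - z) η`, valid for every `z = k + k⁻¹`,
`0 < |k| ≤ 1`, including the points of the spectrum. -/
theorem tendsto_sum_greenKernel {a : ℝ} (ha0 : 0 ≤ a) (ha1 : a < 1) {k : ℂ} (hk : k ≠ 0)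
    (hk1 : ‖k‖ ≤ 1) (η : Ell2) (n : ℕ) :
    Filter.Tendsto (fun M => ∑ j ∈ Finset.range (M + 1), greenKernel a k n j *
      (robinJacobi (a : ℂ) η j.succPNat - (k + k⁻¹) * η j.succPNat)) Filter.atTop
      (nhds (η n.succPNat)) := by
  set x : ℕ → ℂ := fun i => η i.succPNat with hx
  set u := greenKernel (a : ℂ) k n with hu
  have hak : 1 - (a : ℂ) * k ≠ 0 := by
    rw [← norm_pos_iff]
    linarith [le_norm_one_sub_mul ha0 hk1]
  -- For fixed `n` the kernel is bounded in `j`. As `x` tends to 0, this already kills the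
  -- Wronskian; decay of `u` is not available when `|k| = 1`.
  have hub (j : ℕ) : ‖u j‖ ≤ a / (1 - a) + (n + 1) := by
    refine (norm_greenKernel_le ha0 ha1 hk1 n j).trans ?_
    gcongr
    exact min_le_left _ _
  have hx0 : Filter.Tendsto x Filter.atTop (nhds 0) := tendsto_coord_succPNat η
  have hx1 : Filter.Tendsto (fun M => x (M + 1)) Filter.atTop (nhds 0) :=
    hx0.comp (Filter.tendsto_add_atTop_nat 1)
  have hb {y w : ℕ → ℂ} (hy : Filter.Tendsto y Filter.atTop (nhds 0))
      (hw : ∀ j, ‖w j‖ ≤ a / (1 - a) + (n + 1)) :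
      Filter.Tendsto (fun M => w M * y M) Filter.atTop (nhds 0) := by
    have := hy.norm.const_mul (a / (1 - a) + (n + 1))
    rw [norm_zero, mul_zero] at this
    refine squeeze_zero_norm (fun M => ?_) this
    rw [norm_mul]
    gcongr
    exact hw M
  have hlim : Filter.Tendsto (fun M => x n + (u M * x (M + 1) - u (M + 1) * x M)) Filter.atTop
      (nhds (x n)) := by
    have := ((hb hx1 hub).sub (hb (w := fun M => u (M + 1)) hx0 fun j => hub _)).const_add (x n)
    simpa using this
  refine hlim.congr' ?_
  filter_upwards [Filter.eventually_ge_atTop n] with M hM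
  rw [← sum_jacobiSeq (a : ℂ) (k + k⁻¹) u x M, Finset.sum_sub_distrib]
  have h1 : ∑ j ∈ Finset.range (M + 1), jacobiSeq (a : ℂ) (k + k⁻¹) u j * x j = x n := by
    simp_rw [hu, jacobiSeq_greenKernel hk hak]
    simp [hM]
  rw [h1]
  simp_rw [robinJacobi_sub_succPNat]
  ring

/-! ### The weighted estimate, uniform in `z` -/

theorem HasMatrix.hasSum {T : Ell2 →L[ℂ] Ell2} {A : ℕ+ → ℕ+ → ℂ} (hT : HasMatrix T A)
    (x : Ell2) (n : ℕ+) : HasSum (fun m => A n m * x m) (T x n) := by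
  have h := lp.hasSum_single (by norm_num) x
  have h2 := (h.mapL T).mapL (innerSL ℂ (basisVec n))
  have hval : innerSL ℂ (basisVec n) (T x) = T x n := (coord_eq_inner _ _).symm
  rw [hval] at h2
  refine h2.congr_fun fun m => ?_
  have : lp.single 2 m (x m) = x m • basisVec m := by simp [basisVec, ← lp.single_smul]
  rw [this, map_smul, map_smul, innerSL_apply_apply, ← coord_eq_inner, hT n m, smul_eq_mul,
    mul_comm]

theorem norm_le_norm_of_coord {x y : Ell2} (h : ∀ n, ‖x n‖ ≤ ‖y n‖) : ‖x‖ ≤ ‖y‖ := by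
  refine le_of_sq_le_sq ?_ (norm_nonneg _)
  rw [norm_sq_eq, norm_sq_eq]
  refine Summable.tsum_le_tsum (fun n => ?_) (summable_sq x) (summable_sq y)
  gcongr
  exact h n

/-- The coordinatewise absolute value. -/
noncomputable def absVec (x : Ell2) : Ell2 :=
  ⟨fun n => (‖x n‖ : ℂ), memlp_of_summable_sq (by simpa using summable_sq x)⟩

theorem absVec_apply (x : Ell2) (n : ℕ+) : absVec x n = (‖x n‖ : ℂ) := rfl

theorem norm_absVec_le (x : Ell2) : ‖absVec x‖ ≤ ‖x‖ :=
  norm_le_norm_of_coord fun n => by simp [absVec_apply]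

theorem bsMatrix_nonneg {a : ℝ} (ha0 : 0 ≤ a) (ha1 : a < 1) (v : ℕ+ → ℂ) (m n : ℕ+) :
    0 ≤ bsMatrix a v m n := by
  have : 0 ≤ a / (1 - a) := div_nonneg ha0 (by linarith)
  rw [bsMatrix]
  positivity

/-- A diagonal entry of a matrix is at most the operator norm. This is the decay of `v` that the
Weyl sequences need. -/
theorem mul_norm_le_of_hasMatrix {a : ℝ} (ha0 : 0 ≤ a) (ha1 : a < 1) {v : ℕ+ → ℂ}
    {K : Ell2 →L[ℂ] Ell2} (hK : HasMatrix K fun m n => (bsMatrix a v m n : ℂ)) (n : ℕ+) :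
    ‖v n‖ * n ≤ ‖K‖ := by
  have h1 : 0 ≤ a / (1 - a) := div_nonneg ha0 (by linarith)
  have hn : ‖basisVec n‖ = 1 := by rw [basisVec, lp.norm_single (by norm_num), norm_one]
  calc ‖v n‖ * n ≤ ‖v n‖ * (a / (1 - a) + n) := by gcongr; linarith
    _ = bsMatrix a v n n := by
      rw [bsMatrix, min_self, mul_right_comm, Real.mul_self_sqrt (norm_nonneg _)]
    _ = ‖K (basisVec n) n‖ := by
      rw [hK n n, Complex.norm_real, Real.norm_of_nonneg (bsMatrix_nonneg ha0 ha1 _ _ _)]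
    _ ≤ ‖K (basisVec n)‖ := lp.norm_apply_le_norm (by norm_num) _ _
    _ ≤ ‖K‖ := by simpa [hn] using K.le_opNorm (basisVec n)

/-- If `(J_a - z) η = V ψ` then `‖|V|^(1/2) η‖ ≤ ‖K'‖ ‖|V|^(1/2) ψ‖`, for every complex `z`. -/
theorem norm_sqrt_le_of_robinJacobi_sub_eq {a : ℝ} (ha0 : 0 ≤ a) (ha1 : a < 1) {v : ℕ+ → ℂ}
    {K W : Ell2 →L[ℂ] Ell2} (hK : HasMatrix K fun m n => (bsMatrix a v m n : ℂ))
    (hW : IsDiagonal W fun n => (√‖v n‖ : ℂ)) {z : ℂ} {η ψ : Ell2}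
    (h : ∀ m, robinJacobi (a : ℂ) η m - z * η m = v m * ψ m) : ‖W η‖ ≤ ‖K‖ * ‖W ψ‖ := by
  obtain ⟨k, hk, hk1, rfl⟩ := exists_eq_add_inv z
  calc ‖W η‖ ≤ ‖K (absVec (W ψ))‖ := norm_le_norm_of_coord fun n' => ?_
    _ ≤ ‖K‖ * ‖absVec (W ψ)‖ := K.le_opNorm _
    _ ≤ ‖K‖ * ‖W ψ‖ := by gcongr; exact norm_absVec_le _
  obtain ⟨n, rfl⟩ : ∃ n : ℕ, n.succPNat = n' := ⟨n'.natPred, n'.succPNat_natPred⟩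
  have hsum := Complex.hasSum_re (hK.hasSum (absVec (W ψ)) n.succPNat)
  simp only [absVec_apply, ← Complex.ofReal_mul, Complex.ofReal_re] at hsum
  refine le_trans ?_ (Complex.re_le_norm _)
  have hlim := ((tendsto_sum_greenKernel ha0 ha1 hk hk1 η n).const_mul
    (√‖v n.succPNat‖ : ℂ)).norm
  rw [hW]
  -- Each partial Green sum is dominated by a partial sum of the nonnegative series for coordinate
  -- `n` of `K |W ψ|`; `z` no longer appears.
  refine le_of_tendsto' hlim fun M => ?_
  have hle := sum_le_hasSum ((Finset.range (M + 1)).map ⟨Nat.succPNat, Nat.succPNat_injective⟩)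
    (fun m _ => mul_nonneg (bsMatrix_nonneg ha0 ha1 v n.succPNat m) (norm_nonneg _)) hsum
  rw [Finset.sum_map] at hle
  refine le_trans ?_ hle
  rw [Finset.mul_sum]
  refine norm_sum_le_of_le _ fun j _ => ?_
  rw [h, Function.Embedding.coeFn_mk, hW, norm_mul, norm_mul, norm_mul, norm_mul,
    Complex.norm_real, Complex.norm_real, Real.norm_of_nonneg (Real.sqrt_nonneg _),
    Real.norm_of_nonneg (Real.sqrt_nonneg _), bsMatrix]
  have hmin : ((min n.succPNat j.succPNat : ℕ+) : ℝ) = ((min n j : ℕ) : ℝ) + 1 := by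
    rcases le_total n j with h | h
    · rw [min_eq_left h, min_eq_left (Nat.succPNat_le_succPNat.mpr h)]; simp
    · rw [min_eq_right h, min_eq_right (Nat.succPNat_le_succPNat.mpr h)]; simp
  rw [hmin]
  -- Of the two factors `√|v_j|`, one completes the entry of `K'` and the other goes into `W ψ`.
  have hv := Real.mul_self_sqrt (norm_nonneg (v j.succPNat))
  calc √‖v n.succPNat‖ * (‖greenKernel (a : ℂ) k n j‖ * (‖v j.succPNat‖ * ‖ψ j.succPNat‖))
      ≤ √‖v n.succPNat‖ * ((a / (1 - a) + ((min n j : ℕ) + 1)) *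
        (‖v j.succPNat‖ * ‖ψ j.succPNat‖)) := by
        gcongr
        exact norm_greenKernel_le ha0 ha1 hk1 n j
    _ = _ := by
        nth_rewrite 1 [← hv]
        ring

theorem adjoint_diagonal {V V' : Ell2 →L[ℂ] Ell2} {v : ℕ+ → ℂ} (hV : IsDiagonal V v)
    (hV' : IsDiagonal V' fun n => (starRingEnd ℂ) (v n)) :
    ContinuousLinearMap.adjoint V = V' := by
  ext ψ n
  have : V (basisVec n) = v n • basisVec n := by
    ext m
    rw [hV]
    change v m * basisVec n m = v n * basisVec n m
    by_cases h : m = n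
    · rw [h]
    · simp [h]
  rw [adjoint_apply_coord, this, inner_smul_left, ← coord_eq_inner, hV']

/-! ### Injectivity and dense range at every `z`, invertibility off `[-2,2]` -/

/-- The operators `J_a + V` and `J_a + V*`, their coupling `|V|^(1/2)`, and the bounded matrix
operator `K'` of norm less than one. -/
structure Perturbation (a : ℝ) (v : ℕ+ → ℂ) (V W K : Ell2 →L[ℂ] Ell2) : Prop where
  nonneg : 0 ≤ a
  lt_one : a < 1
  isDiagonal : IsDiagonal V v
  isDiagonal_sqrt : IsDiagonal W fun n => (√‖v n‖ : ℂ)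
  hasMatrix : HasMatrix K fun m n => (bsMatrix a v m n : ℂ)
  norm_lt : ‖K‖ < 1

namespace Perturbation

variable {a : ℝ} {v : ℕ+ → ℂ} {V W K : Ell2 →L[ℂ] Ell2}

theorem mul_norm_le (hP : Perturbation a v V W K) (n : ℕ+) : ‖v n‖ * n ≤ 1 :=
  (mul_norm_le_of_hasMatrix hP.nonneg hP.lt_one hP.hasMatrix n).trans hP.norm_lt.le

theorem norm_le_one (hP : Perturbation a v V W K) (n : ℕ+) : ‖v n‖ ≤ 1 := by
  have h1 : (1 : ℝ) ≤ n := by exact_mod_cast n.pos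
  have h2 := hP.mul_norm_le n
  nlinarith [norm_nonneg (v n)]

theorem sub_apply (hP : Perturbation a v V W K) (z : ℂ) (ψ : Ell2) (n : ℕ+) :
    (robinJacobi (a : ℂ) + V - z • ContinuousLinearMap.id ℂ Ell2) ψ n =
      robinJacobi (a : ℂ) ψ n + v n * ψ n - z * ψ n := by
  rw [← hP.isDiagonal]
  rfl

theorem injective (hP : Perturbation a v V W K) (z : ℂ) :
    Function.Injective (robinJacobi (a : ℂ) + V - z • ContinuousLinearMap.id ℂ Ell2) := by
  refine (injective_iff_map_eq_zero _).mpr fun ψ hψ => ?_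
  have h (n : ℕ+) : robinJacobi (a : ℂ) ψ n - z * ψ n = v n * (-ψ) n := by
    have h1 := hP.sub_apply z ψ n
    rw [hψ] at h1
    have h2 : (-ψ) n = -ψ n := rfl
    have h3 : (0 : Ell2) n = 0 := rfl
    rw [h3] at h1
    rw [h2]
    linear_combination -h1
  have hle := norm_sqrt_le_of_robinJacobi_sub_eq hP.nonneg hP.lt_one hP.hasMatrix
    hP.isDiagonal_sqrt h
  rw [map_neg, norm_neg] at hle
  have hW0 : W ψ = 0 := by
    rw [← norm_eq_zero]
    nlinarith [norm_nonneg (W ψ), hP.norm_lt]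
  -- `W ψ = 0` gives `V ψ = 0`, so every term of the Green sums for `ψ` vanishes, and so does their
  -- limit `ψ`.
  have hv0 (n : ℕ+) : v n * (-ψ) n = 0 := by
    have h1 := hP.isDiagonal_sqrt ψ n
    rw [hW0] at h1
    have h2 : (-ψ) n = -ψ n := rfl
    rcases mul_eq_zero.mp h1.symm with h3 | h3
    · rw [Complex.ofReal_eq_zero, Real.sqrt_eq_zero (norm_nonneg _), norm_eq_zero] at h3
      rw [h3, zero_mul]
    · rw [h2, h3, neg_zero, mul_zero]
  obtain ⟨k, hk, hk1, rfl⟩ := exists_eq_add_inv z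
  ext n'
  obtain ⟨n, rfl⟩ : ∃ n : ℕ, n.succPNat = n' := ⟨n'.natPred, n'.succPNat_natPred⟩
  refine tendsto_nhds_unique (tendsto_sum_greenKernel hP.nonneg hP.lt_one hk hk1 ψ n) ?_
  simp only [h, hv0, mul_zero, Finset.sum_const_zero]
  exact tendsto_const_nhds

/-- The adjoint has the conjugate potential, with the same moduli and hence the same `K`, so it is
injective too. -/
theorem denseRange (hP : Perturbation a v V W K) (z : ℂ) :
    DenseRange (robinJacobi (a : ℂ) + V - z • ContinuousLinearMap.id ℂ Ell2) := by
  set v' : ℕ+ → ℂ := fun n => (starRingEnd ℂ) (v n) with hv'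
  have hnorm (n : ℕ+) : ‖v' n‖ = ‖v n‖ := RCLike.norm_conj _
  set V' := diagonal v' 1 fun n => (hnorm n).trans_le (hP.norm_le_one n) with hV'
  have hdiag : IsDiagonal V' v' := isDiagonal_diagonal _ _ _
  have hP' : Perturbation a v' V' W K := by
    refine ⟨hP.nonneg, hP.lt_one, hdiag, ?_, ?_, hP.norm_lt⟩
    · simpa only [hnorm] using hP.isDiagonal_sqrt
    · simpa only [bsMatrix, hnorm] using hP.hasMatrix
  apply denseRange_of_adjoint_injective
  have hid : ContinuousLinearMap.adjoint (ContinuousLinearMap.id ℂ Ell2) =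
      ContinuousLinearMap.id ℂ Ell2 := ContinuousLinearMap.adjoint_id
  rw [map_sub, map_add, map_smulₛₗ, adjoint_robinJacobi, adjoint_diagonal hP.isDiagonal hdiag, hid]
  exact hP'.injective _

theorem norm_apply_le (hP : Perturbation a v V W K) (ψ : Ell2) : ‖V ψ‖ ≤ ‖W ψ‖ := by
  refine norm_le_norm_of_coord fun n => ?_
  rw [hP.isDiagonal, hP.isDiagonal_sqrt, norm_mul, norm_mul, Complex.norm_real,
    Real.norm_of_nonneg (Real.sqrt_nonneg _)]
  gcongr
  exact Real.le_sqrt_of_sq_le (by nlinarith [norm_nonneg (v n), hP.norm_le_one n])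

theorem isUnit_sub (hP : Perturbation a v V W K) {z : ℂ}
    (hz : z ∉ Complex.ofReal '' Set.Icc (-2 : ℝ) 2) :
    IsUnit (robinJacobi (a : ℂ) + V - z • ContinuousLinearMap.id ℂ Ell2) := by
  obtain ⟨R, hR⟩ := (isUnit_robinJacobi_sub (by linarith [hP.nonneg]) hP.lt_one.le hz).exists_right_inv
  obtain ⟨L, hL⟩ := (isUnit_robinJacobi_sub (by linarith [hP.nonneg]) hP.lt_one.le hz).exists_left_inv
  have hR' (φ : Ell2) : robinJacobi (a : ℂ) (R φ) - z • R φ = φ := by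
    have := congrArg (fun T : Ell2 →L[ℂ] Ell2 => T φ) hR
    exact this
  have hL' (ψ : Ell2) : L (robinJacobi (a : ℂ) ψ - z • ψ) = ψ := by
    have := congrArg (fun T : Ell2 →L[ℂ] Ell2 => T ψ) hL
    exact this
  have hq : 0 < 1 - ‖K‖ := by linarith [hP.norm_lt]
  set C : ℝ := ‖L‖ * (1 + ‖W‖ * ‖R‖ / (1 - ‖K‖)) with hC
  have hC0 : 0 ≤ C := by positivity
  have hbound (ψ : Ell2) : ‖ψ‖ ≤
      C * ‖(robinJacobi (a : ℂ) + V - z • ContinuousLinearMap.id ℂ Ell2) ψ‖ := by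
    set φ := (robinJacobi (a : ℂ) + V - z • ContinuousLinearMap.id ℂ Ell2) ψ with hφ
    have hφ' : robinJacobi (a : ℂ) ψ - z • ψ = φ - V ψ := by
      have : φ = robinJacobi (a : ℂ) ψ + V ψ - z • ψ := rfl
      rw [this]; abel
    -- With `η = ψ - R φ` the weighted estimate reads `‖W ψ - W R φ‖ ≤ ‖K‖ ‖W ψ‖`; solving for `‖W
    -- ψ‖` produces the `1 - ‖K‖` in `C`.
    have hη : robinJacobi (a : ℂ) (ψ - R φ) - z • (ψ - R φ) = V (-ψ) := by
      have h1 := hR' φ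
      rw [map_sub, smul_sub, map_neg]
      calc _ = (robinJacobi (a : ℂ) ψ - z • ψ) - (robinJacobi (a : ℂ) (R φ) - z • R φ) := by abel
        _ = _ := by rw [h1, hφ']; abel
    have hcoord (m : ℕ+) : robinJacobi (a : ℂ) (ψ - R φ) m - z * (ψ - R φ) m = v m * (-ψ) m := by
      rw [← hP.isDiagonal, ← hη]
      rfl
    have hle := norm_sqrt_le_of_robinJacobi_sub_eq hP.nonneg hP.lt_one hP.hasMatrix
      hP.isDiagonal_sqrt hcoord
    rw [map_neg, norm_neg, map_sub] at hle
    have hWR : ‖W (R φ)‖ ≤ ‖W‖ * ‖R‖ * ‖φ‖ := by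
      rw [mul_assoc]
      exact (W.le_opNorm _).trans (by gcongr; exact R.le_opNorm φ)
    have htri := norm_sub_norm_le (W ψ) (W (R φ))
    have hWψ : ‖W ψ‖ ≤ ‖W‖ * ‖R‖ / (1 - ‖K‖) * ‖φ‖ := by
      rw [div_mul_eq_mul_div, le_div_iff₀ hq]
      linarith
    calc ‖ψ‖ = ‖L (φ - V ψ)‖ := by rw [← hφ', hL']
      _ ≤ ‖L‖ * ‖φ - V ψ‖ := L.le_opNorm _
      _ ≤ ‖L‖ * (‖φ‖ + ‖W‖ * ‖R‖ / (1 - ‖K‖) * ‖φ‖) := by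
        gcongr
        exact (norm_sub_le _ _).trans (by gcongr; exact (hP.norm_apply_le ψ).trans hWψ)
      _ = C * ‖φ‖ := by rw [hC]; ring
  rw [ContinuousLinearMap.isUnit_iff_bijective,
    ContinuousLinearMap.bijective_iff_dense_range_and_antilipschitz]
  refine ⟨?_, ⟨C, hC0⟩, AddMonoidHomClass.antilipschitz_of_bound _ hbound⟩
  exact Submodule.dense_iff_topologicalClosure_eq_top.mp (hP.denseRange z)

end Perturbation

/-! ### Weyl sequences -/

theorem robinJacobi_basisVec (a : ℂ) (n : ℕ) :
    robinJacobi a (basisVec (n + 1).succPNat) =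
      basisVec n.succPNat + basisVec (n + 2).succPNat := by
  refine ext_coord ?_ fun m => ?_
  · have h : (basisVec n.succPNat + basisVec (n + 2).succPNat) 1 =
      basisVec n.succPNat 1 + basisVec (n + 2).succPNat 1 := rfl
    rw [robinJacobi_apply_one, h]
    simp only [lp.single_apply, Pi.single_apply, ← PNat.coe_inj, Nat.succPNat_coe,
      PNat.val_ofNat, Nat.succ_eq_add_one]
    simp
  · have h : (basisVec n.succPNat + basisVec (n + 2).succPNat) (m + 1) =
      basisVec n.succPNat (m + 1) + basisVec (n + 2).succPNat (m + 1) := rfl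
    have hm : ((m + 2 : ℕ+) : ℕ) = m + 2 := rfl
    rw [robinJacobi_apply_succ, h]
    simp only [lp.single_apply, Pi.single_apply, ← PNat.coe_inj, Nat.succPNat_coe, PNat.add_coe,
      PNat.one_coe, Nat.succ_eq_add_one, hm]
    have e1 : ((m : ℕ) = n + 1 + 1) = ((m : ℕ) + 1 = n + 2 + 1) := by
      apply propext; omega
    have e2 : ((m : ℕ) + 2 = n + 1 + 1) = ((m : ℕ) + 1 = n + 1) := by
      apply propext; omega
    simp only [e1, e2]
    ring

/-- The truncated plane wave `∑_{j < M} w^j e_{N + 1 + j}` (with zero-based positions). -/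
noncomputable def planeWave (w : ℂ) (N M : ℕ) : Ell2 :=
  ∑ j ∈ Finset.range M, w ^ j • basisVec (N + j + 1).succPNat

theorem norm_planeWave {w : ℂ} (hw : ‖w‖ = 1) (N M : ℕ) : ‖planeWave w N M‖ ^ 2 = M := by
  have hinj : Function.Injective fun j : ℕ => (N + j + 1).succPNat := fun i j h => by
    have := Nat.succPNat_injective h
    omega
  -- Coefficients here are indexed by position, so the exponent `j` is recovered as the zero-based
  -- position minus `N + 1`.
  have h := lp.norm_sum_single (E := fun _ : ℕ+ => ℂ) (p := 2) (by norm_num)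
    (fun i => w ^ (i.natPred - (N + 1))) ((Finset.range M).map ⟨_, hinj⟩)
  simp only [ENNReal.toReal_ofNat, Real.rpow_ofNat, Finset.sum_map, Function.Embedding.coeFn_mk,
    norm_pow, hw, one_pow, Finset.sum_const, Finset.card_map, Finset.card_range, nsmul_eq_mul, mul_one] at h
  rw [← h, planeWave]
  congr 2
  refine Finset.sum_congr rfl fun j _ => ?_
  rw [basisVec, ← lp.single_smul, Nat.natPred_succPNat, smul_eq_mul, mul_one]
  congr 2
  omega

theorem planeWave_apply_of_le (w : ℂ) (N M : ℕ) {n : ℕ+} (hn : (n : ℕ) ≤ N) :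
    planeWave w N M n = 0 := by
  rw [planeWave, lp.coeFn_sum, Finset.sum_apply]
  refine Finset.sum_eq_zero fun j _ => ?_
  have hne : n ≠ (N + j + 1).succPNat := fun h => by
    rw [h, Nat.succPNat_coe] at hn
    omega
  change w ^ j * basisVec (N + j + 1).succPNat n = 0
  rw [basisVec, lp.single_apply_ne _ _ _ hne, mul_zero]

/-- The powers `w^j` solve the recurrence in the interior and the support avoids the corner, so only
terms at the two ends survive. -/
theorem robinJacobi_planeWave (a : ℂ) {w : ℂ} (hw : w ≠ 0) (N M : ℕ) :
    robinJacobi a (planeWave w N M) - (w + w⁻¹) • planeWave w N M =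
      (basisVec N.succPNat - w⁻¹ • basisVec (N + 1).succPNat) -
        w ^ M • (basisVec (N + M).succPNat - w⁻¹ • basisVec (N + M + 1).succPNat) := by
  induction M with
  | zero => simp [planeWave]
  | succ M ih =>
    have h : planeWave w N (M + 1) = planeWave w N M + w ^ M • basisVec (N + M + 1).succPNat :=
      Finset.sum_range_succ _ _
    rw [h, map_add, smul_add, map_smul, robinJacobi_basisVec]
    rw [sub_eq_iff_eq_add] at ih
    rw [ih, ← add_assoc N M 1, pow_succ]
    have h1 : w * w⁻¹ = 1 := mul_inv_cancel₀ hw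
    match_scalars <;> first | ring1 | linear_combination -(w ^ M) * h1

theorem norm_robinJacobi_planeWave_le (a : ℂ) {w : ℂ} (hw : ‖w‖ = 1) (N M : ℕ) :
    ‖robinJacobi a (planeWave w N M) - (w + w⁻¹) • planeWave w N M‖ ≤ 4 := by
  have hw0 : w ≠ 0 := by rw [← norm_ne_zero_iff, hw]; exact one_ne_zero
  have hn (n : ℕ+) : ‖basisVec n‖ = 1 := by rw [basisVec, lp.norm_single (by norm_num), norm_one]
  have h2 (m n : ℕ+) : ‖basisVec m - w⁻¹ • basisVec n‖ ≤ 2 := by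
    refine (norm_sub_le _ _).trans ?_
    rw [norm_smul, norm_inv, hw, hn, hn]
    norm_num
  rw [robinJacobi_planeWave a hw0]
  refine (norm_sub_le _ _).trans ?_
  rw [norm_smul, norm_pow, hw, one_pow, one_mul]
  linarith [h2 N.succPNat (N + 1).succPNat, h2 (N + M).succPNat (N + M + 1).succPNat]

theorem exists_norm_eq_one_add_inv {x : ℝ} (hx : x ∈ Set.Icc (-2 : ℝ) 2) :
    ∃ w : ℂ, ‖w‖ = 1 ∧ (x : ℂ) = w + w⁻¹ := by
  refine ⟨Complex.exp (Real.arccos (x / 2) * Complex.I), Complex.norm_exp_ofReal_mul_I _, ?_⟩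
  have h : Real.cos (Real.arccos (x / 2)) = x / 2 :=
    Real.cos_arccos (by linarith [hx.1]) (by linarith [hx.2])
  rw [← Complex.exp_neg, ← neg_mul, ← Complex.two_cos, ← Complex.ofReal_cos, h]
  push_cast
  ring

theorem Perturbation.not_isUnit_sub {a : ℝ} {v : ℕ+ → ℂ} {V W K : Ell2 →L[ℂ] Ell2}
    (hP : Perturbation a v V W K) {x : ℝ} (hx : x ∈ Set.Icc (-2 : ℝ) 2) :
    ¬ IsUnit (robinJacobi (a : ℂ) + V - (x : ℂ) • ContinuousLinearMap.id ℂ Ell2) := by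
  intro hu
  obtain ⟨L, hL⟩ := hu.exists_left_inv
  obtain ⟨w, hw, hxw⟩ := exists_norm_eq_one_add_inv hx
  set C := ‖L‖ + 1 with hC
  have hC0 : 0 < C := by positivity
  -- Beyond `N` one has `|v_n| ≤ 1/(2C)`, so `V` costs at most half of `‖ψ‖`. The end terms cost at
  -- most `4C`, so `‖ψ‖ ≤ 8C`, which `‖ψ‖² = M > (8C)²` contradicts.
  obtain ⟨N, hN⟩ := exists_nat_gt (2 * C)
  obtain ⟨M, hM⟩ := exists_nat_gt ((8 * C) ^ 2)
  set ψ := planeWave w N M with hψ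
  have hδ (n : ℕ+) (hn : N < (n : ℕ)) : ‖v n‖ ≤ (2 * C)⁻¹ := by
    have h1 := hP.mul_norm_le n
    have h2 : 2 * C ≤ n := hN.le.trans (by exact_mod_cast hn.le)
    rw [← one_div, le_div_iff₀ (by positivity)]
    exact (mul_le_mul_of_nonneg_left h2 (norm_nonneg _)).trans h1
  have hV : ‖V ψ‖ ≤ (2 * C)⁻¹ * ‖ψ‖ := by
    have hs : ‖((2 * C)⁻¹ : ℂ) • ψ‖ = (2 * C)⁻¹ * ‖ψ‖ := by
      rw [norm_smul]
      congr 1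
      rw [← Complex.ofReal_ofNat, ← Complex.ofReal_mul, ← Complex.ofReal_inv, Complex.norm_real,
        Real.norm_of_nonneg (by positivity)]
    rw [← hs]
    refine norm_le_norm_of_coord fun n => ?_
    have hs' : ‖(((2 * C)⁻¹ : ℂ) • ψ) n‖ = (2 * C)⁻¹ * ‖ψ n‖ := by
      change ‖((2 * C)⁻¹ : ℂ) * ψ n‖ = _
      rw [norm_mul]
      congr 1
      rw [← Complex.ofReal_ofNat, ← Complex.ofReal_mul, ← Complex.ofReal_inv, Complex.norm_real,
        Real.norm_of_nonneg (by positivity)]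
    rw [hP.isDiagonal, norm_mul, hs']
    rcases le_or_gt (n : ℕ) N with hn | hn
    · rw [hψ, planeWave_apply_of_le w N M hn]; simp
    · gcongr; exact hδ n hn
  have hL' : L (robinJacobi (a : ℂ) ψ - (x : ℂ) • ψ + V ψ) = ψ := by
    have h1 := congrArg (fun T : Ell2 →L[ℂ] Ell2 => T ψ) hL
    have h2 : L (robinJacobi (a : ℂ) ψ + V ψ - (x : ℂ) • ψ) = ψ := h1
    rw [← h2]
    congr 1
    rw [h2]; abel
  have h4 : ‖robinJacobi (a : ℂ) ψ - (x : ℂ) • ψ‖ ≤ 4 := by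
    rw [hxw]; exact norm_robinJacobi_planeWave_le _ hw N M
  have hfin : ‖ψ‖ ≤ C * (4 + (2 * C)⁻¹ * ‖ψ‖) := by
    calc ‖ψ‖ = ‖L (robinJacobi (a : ℂ) ψ - (x : ℂ) • ψ + V ψ)‖ := by rw [hL']
      _ ≤ ‖L‖ * ‖robinJacobi (a : ℂ) ψ - (x : ℂ) • ψ + V ψ‖ := L.le_opNorm _
      _ ≤ C * (4 + (2 * C)⁻¹ * ‖ψ‖) := by
        gcongr
        · rw [hC]; linarith
        · exact (norm_add_le _ _).trans (add_le_add h4 hV)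
  have h8 : ‖ψ‖ ≤ 8 * C := by
    have : C * (4 + (2 * C)⁻¹ * ‖ψ‖) = 4 * C + ‖ψ‖ / 2 := by field_simp
    linarith
  have hsq : ‖ψ‖ ^ 2 ≤ (8 * C) ^ 2 := by gcongr
  rw [hψ, norm_planeWave hw] at hsq
  linarith

/-! ### Assembly of the spectral statements -/

theorem mem_spectrum_iff (T : Ell2 →L[ℂ] Ell2) (z : ℂ) :
    z ∈ spectrum ℂ T ↔ ¬ IsUnit (T - z • ContinuousLinearMap.id ℂ Ell2) := by
  rw [spectrum.mem_iff, ← IsUnit.neg_iff, neg_sub, Algebra.algebraMap_eq_smul_one]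
  rfl

namespace Perturbation

variable {a : ℝ} {v : ℕ+ → ℂ} {V W K : Ell2 →L[ℂ] Ell2}

theorem spectrum_eq (hP : Perturbation a v V W K) :
    spectrum ℂ (robinJacobi (a : ℂ) + V) = Complex.ofReal '' Set.Icc (-2 : ℝ) 2 := by
  ext z
  rw [mem_spectrum_iff]
  refine ⟨fun h => by_contra fun hz => h (hP.isUnit_sub hz), ?_⟩
  rintro ⟨x, hx, rfl⟩
  exact hP.not_isUnit_sub hx

theorem continuousSpectrum_eq (hP : Perturbation a v V W K) :
    continuousSpectrum (robinJacobi (a : ℂ) + V) = spectrum ℂ (robinJacobi (a : ℂ) + V) :=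
  Set.ext fun z => ⟨fun h => h.1, fun h => ⟨h, hP.injective z, hP.denseRange z⟩⟩

end Perturbation

theorem spectrum_robinJacobi {a : ℝ} (ha0 : 0 ≤ a) (ha1 : a < 1) :
    spectrum ℂ (robinJacobi (a : ℂ)) = Complex.ofReal '' Set.Icc (-2 : ℝ) 2 := by
  have hP : Perturbation a 0 0 0 0 := by
    refine ⟨ha0, ha1, fun ψ n => ?_, fun ψ n => ?_, fun m n => ?_, by simp⟩
    · simp
    · simp
    · simp [bsMatrix]
  simpa using hP.spectrum_eq

theorem exists_perturbation {a : ℝ} (ha0 : 0 ≤ a) (ha1 : a < 1) {v : ℕ+ → ℂ}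
    (h : BSNormLtOne a v) : ∃ V W K, Perturbation a v V W K := by
  obtain ⟨K, hK, hK1⟩ := h
  have hv (n : ℕ+) : ‖v n‖ ≤ 1 := by
    have h1 : (1 : ℝ) ≤ n := by exact_mod_cast n.pos
    nlinarith [norm_nonneg (v n), mul_norm_le_of_hasMatrix ha0 ha1 hK n]
  have hw (n : ℕ+) : ‖((√‖v n‖ : ℝ) : ℂ)‖ ≤ 1 := by
    rw [Complex.norm_real, Real.norm_of_nonneg (Real.sqrt_nonneg _)]
    exact Real.sqrt_le_one.mpr (hv n)
  exact ⟨diagonal v 1 hv, diagonal _ 1 hw, K, ha0, ha1, isDiagonal_diagonal _ _ _,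
    isDiagonal_diagonal _ _ _, hK, hK1⟩

end RobinSpectral

theorem theorem5p2 (a : ℝ) (ha0 : 0 ≤ a) (ha1 : a < 1) (v : ℕ+ → ℂ) :
    (RobinSpectral.BSNormLtOne a v ↔ ∃ c : ℝ, c < 1 ∧ RobinSpectral.FormBound a v c) ∧
    ((RobinSpectral.BSNormLtOne a v ∨ ∃ c : ℝ, c < 1 ∧ RobinSpectral.FormBound a v c) →
      ∃ V : RobinSpectral.Ell2 →L[ℂ] RobinSpectral.Ell2, RobinSpectral.IsDiagonal V v ∧
        spectrum ℂ (RobinSpectral.robinJacobi (a : ℂ) + V) =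
          RobinSpectral.continuousSpectrum (RobinSpectral.robinJacobi (a : ℂ) + V) ∧
        RobinSpectral.continuousSpectrum (RobinSpectral.robinJacobi (a : ℂ) + V) =
          spectrum ℂ (RobinSpectral.robinJacobi (a : ℂ)) ∧
        spectrum ℂ (RobinSpectral.robinJacobi (a : ℂ)) =
          Complex.ofReal '' Set.Icc (-2 : ℝ) 2) := by
  have hiff := RobinSpectral.bsNormLtOne_iff_formBound ha1 v
  refine ⟨hiff, fun h => ?_⟩
  obtain ⟨V, W, K, hP⟩ := RobinSpectral.exists_perturbation ha0 ha1 (h.elim id hiff.mpr)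
  have hJ := RobinSpectral.spectrum_robinJacobi ha0 ha1
  exact ⟨V, hP.isDiagonal, hP.continuousSpectrum_eq.symm,
    hP.continuousSpectrum_eq.trans (hP.spectrum_eq.trans hJ.symm), hJ⟩
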